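/- For a loopless matroid $M$ on a finite ground set $E$, with lattice of flats $\mathcal L(M)$ and rank function $\mathrm{rk}$, let $\mu_M=\mu(\emptyset,E)$ be the value of the Möbius function of $\mathcal L(M)$ at its least and greatest elements, and let $\chi_M(t)=\sum_{F\in\mathcal L(M)}\mu_{M|_F}\,t^{\mathrm{rk}(M/F)}$ be the characteristic polynomial. Let $P_M(t)\in\mathbb Z[t]$ be the Kazhdan–Lusztig polynomial of $M$, determined by: $P_M=1$ if $\mathrm{rk}(M)=0$; $\deg P_M<\tfrac12\mathrm{rk}(M)$ if $\mathrm{rk}(M)>0$; and $t^{\mathrm{rk}(M)}P_M(t^{-1})=\sum_{F\in\mathcal L(M)}\chi_{M|_F}(t)\,P_{M/F}(t)$. Let $Q_M(t)\in\mathbb Z[t]$ be the inverse Kazhdan–Lusztig polynomial, determined by: $Q_M=1$ if $\mathrm{rk}(M)=0$; and $\sum_{F\in\mathcal L(M)}(-1)^{\mathrm{rk}(M|_F)}P_{M|_F}(t)\,Q_{M/F}(t)=0$ if $\mathrm{rk}(M)>0$. The inverse $Z$-polynomial of $M$ is $$Y_M(t)=(-1)^{\mathrm{rk}(M)}\sum_{F\in\mathcal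 L(M)}(-1)^{\mathrm{rk}(M|_F)}\,Q_{M|_F}(t)\,t^{\mathrm{rk}(M/F)}\,\mu_{M/F}.$$ (For a matroid with loops, $Y_M$ is defined to be the inverse $Z$-polynomial of the matroid obtained by deleting the loops.) **Theorem.** Let $n\ge k\ge 1$ be integers and let $\mathsf U_{k,n}$ be the uniform matroid of rank $k$ on $n$ elements, i.e. the matroid on $\{1,\dots,n\}$ whose bases are all $k$-element subsets. Then $$Y_{\mathsf U_{k,n}}(t)=\sum_{i=0}^{\lfloor k/2\rfloor}\binom ni\binom{n-i-1}{n-k}t^i+\sum_{i=0}^{\lfloor (k-1)/2\rfloor}\binom ni\binom{n-i-1}{n-k}t^{k-i}.$$ -/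

import Mathlib

open scoped Polynomial Matroid
open Polynomial

namespace InverseZ

/-! Matroids are Mathlib matroids `M : Matroid α` on a finite type `α`. The ground set `M.E` is an
arbitrary subset of `α`, so that every restriction `M ↾ F` and every contraction `M ／ F` is again a
matroid on `α`. -/

/-- The flats of `M`, partially ordered by inclusion: the lattice of flats `𝓛(M)`. -/
abbrev Flats {α : Type*} (M : Matroid α) : Type _ := {F : Set α // M.IsFlat F}

noncomputable instance instFintypeFlats {α : Type*} [Finite α] (M : Matroid α) :
    Fintype (Flats M) := Fintype.ofFinite _

open Classical in
noncomputable instance instLocallyFiniteOrderFlats {α : Type*} [Finite α] (M : Matroid α) :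
    LocallyFiniteOrder (Flats M) := Fintype.toLocallyFiniteOrder

/-- The least flat, i.e. the closure of `∅` (the set of loops, which is `∅` if `M` is loopless). -/
def botFlat {α : Type*} (M : Matroid α) : Flats M := ⟨M.closure ∅, M.isFlat_closure ∅⟩

/-- The greatest flat, i.e. the ground set. -/
def topFlat {α : Type*} (M : Matroid α) : Flats M := ⟨M.E, M.ground_isFlat⟩

/-- The flats other than the least one. -/
abbrev PosFlats {α : Type*} (M : Matroid α) : Type _ :=
  {F : Set α // M.IsFlat F ∧ F ≠ M.closure ∅}

noncomputable instance instFintypePosFlats {α : Type*} [Finite α] (M : Matroid α) :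
    Fintype (PosFlats M) := Fintype.ofFinite _

/-- The rank of a matroid, as a natural number. -/
noncomputable def rk {α : Type*} (M : Matroid α) : ℕ := M.eRank.toNat

open Classical in
/-- The Möbius invariant `μ_M`: the Möbius function of the lattice of flats, evaluated at the pair
(least flat, greatest flat). -/
noncomputable def mobius {α : Type*} [Finite α] (M : Matroid α) : ℤ :=
  IncidenceAlgebra.mu ℤ (botFlat M) (topFlat M)

/-- The characteristic polynomial `χ_M(t) = ∑_F μ_{M|F} t ^ rk (M / F)`, over all flats `F`. -/
noncomputable def charPoly {α : Type*} [Finite α] (M : Matroid α) : ℤ[X] :=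
  ∑ F : Flats M, C (mobius (M ↾ F.1)) * X ^ rk (M ／ F.1)

/-- The polynomial `p` with `deg p < r / 2` and `t ^ r p(1 / t) = p(t) + S(t)`. There is at most
one (`klSolve_unique`); the value is `0` if there is none. -/
noncomputable def klSolve (r : ℕ) (S : ℤ[X]) : ℤ[X] :=
  open Classical in
  if h : ∃ p : ℤ[X], 2 * p.natDegree < r ∧ p.reflect r = p + S then h.choose else 0

theorem klSolve_unique {r : ℕ} {S p q : ℤ[X]}
    (hp : 2 * p.natDegree < r ∧ p.reflect r = p + S)
    (hq : 2 * q.natDegree < r ∧ q.reflect r = q + S) : p = q := by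
  ext i
  by_cases hi : 2 * i < r
  · have h1 := congrArg (fun f => f.coeff i) hp.2
    have h2 := congrArg (fun f => f.coeff i) hq.2
    simp only [coeff_reflect, coeff_add, revAt_le (show i ≤ r by omega)] at h1 h2
    rw [coeff_eq_zero_of_natDegree_lt (by omega)] at h1
    rw [coeff_eq_zero_of_natDegree_lt (by omega)] at h2
    linarith
  · rw [coeff_eq_zero_of_natDegree_lt (by omega), coeff_eq_zero_of_natDegree_lt (by omega)]

theorem contract_ground_ncard_lt {α : Type*} [Finite α] (M : Matroid α) {F : Set α}
    (hF : M.IsFlat F ∧ F ≠ M.closure ∅) : (M ／ F).E.ncard < M.E.ncard := by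
  have hne : F.Nonempty := by
    rw [Set.nonempty_iff_ne_empty]
    rintro rfl
    exact hF.2 hF.1.closure.symm
  obtain ⟨x, hx⟩ := hne
  refine Set.ncard_lt_ncard ?_ (Set.toFinite _)
  rw [Matroid.contract_ground]
  exact ⟨Set.sdiff_subset, fun h => (h (hF.1.subset_ground hx)).2 hx⟩

/-- The Kazhdan–Lusztig polynomial `P_M` of a matroid. It is determined by the conditions
* if `rk M = 0`, then `P_M = 1`;
* if `rk M > 0`, then `deg P_M < rk M / 2`;
* `t ^ rk M * P_M(1 / t) = ∑_F χ_{M|F}(t) P_{M/F}(t)`, over all flats `F`.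

In the third condition the term of the least flat is `P_M` itself (as `χ_{M|F} = 1` there), and the
other terms involve smaller matroids, so the conditions define `P_M` recursively. -/
noncomputable def klPoly {α : Type*} [Finite α] (M : Matroid α) : ℤ[X] :=
  if rk M = 0 then 1
  else klSolve (rk M) (∑ F : PosFlats M, charPoly (M ↾ F.1) * klPoly (M ／ F.1))
termination_by M.E.ncard
decreasing_by exact contract_ground_ncard_lt M F.2

/-- The inverse Kazhdan–Lusztig polynomial `Q_M` of a matroid. It is determined by the conditions
* if `rk M = 0`, then `Q_M = 1`;
* if `rk M > 0`, then `∑_F (-1) ^ rk (M|F) P_{M|F}(t) Q_{M/F}(t) = 0`, over all flats `F`.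

The term of the least flat is `Q_M` itself. -/
noncomputable def invKLPoly {α : Type*} [Finite α] (M : Matroid α) : ℤ[X] :=
  if rk M = 0 then 1
  else -∑ F : PosFlats M, (-1) ^ rk (M ↾ F.1) * klPoly (M ↾ F.1) * invKLPoly (M ／ F.1)
termination_by M.E.ncard
decreasing_by exact contract_ground_ncard_lt M F.2

/-- The polynomial `Ŷ_M(t) = ∑_F (-1) ^ rk (M|F) Q_{M|F}(t) t ^ rk (M/F) μ_{M/F}`, over all flats
`F` of a (loopless) matroid `M`. -/
noncomputable def hatY {α : Type*} [Finite α] (M : Matroid α) : ℤ[X] :=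
  ∑ F : Flats M,
    (-1) ^ rk (M ↾ F.1) * invKLPoly (M ↾ F.1) * X ^ rk (M ／ F.1) * C (mobius (M ／ F.1))

/-- The inverse `Z`-polynomial: `Y_M = (-1) ^ rk M * Ŷ_M` for loopless `M`, and
`Y_M = Y_{M ＼ loops}` in general. -/
noncomputable def inverseZPoly {α : Type*} [Finite α] (M : Matroid α) : ℤ[X] :=
  (-1) ^ rk (M ＼ M.loops) * hatY (M ＼ M.loops)

/-- The uniform matroid `U_{k,n}` on the ground set `Fin n`: the independent sets are the sets with
at most `k` elements. For `k ≤ n` its bases are exactly the `k`-element sets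
(`uniform_isBase_iff`). -/
noncomputable def uniform (k n : ℕ) : Matroid (Fin n) :=
  (IndepMatroid.ofFinite (E := Set.univ) Set.finite_univ
    (fun I => I.ncard ≤ k)
    (by simp)
    (fun _ J hJ hIJ => (Set.ncard_le_ncard hIJ (Set.toFinite J)).trans hJ)
    (fun I J _ hJ hlt => by
      obtain ⟨e, heJ, heI⟩ := Set.exists_mem_notMem_of_ncard_lt_ncard hlt
      refine ⟨e, heJ, heI, ?_⟩
      rw [Set.ncard_insert_of_notMem heI]
      omega)
    (fun _ _ => Set.subset_univ _)).matroid

theorem uniform_ground (k n : ℕ) : (uniform k n).E = Set.univ := rfl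

theorem uniform_indep_iff (k n : ℕ) (I : Set (Fin n)) :
    (uniform k n).Indep I ↔ I.ncard ≤ k := Iff.rfl

theorem uniform_isBase_iff {k n : ℕ} (hkn : k ≤ n) (B : Set (Fin n)) :
    (uniform k n).IsBase B ↔ B.ncard = k := by
  rw [Matroid.isBase_iff_maximal_indep]
  constructor
  · intro h
    have hB : B.ncard ≤ k := h.prop
    by_contra hne
    have hlt : B.ncard < (Set.univ : Set (Fin n)).ncard := by
      rw [Set.ncard_univ, Nat.card_eq_fintype_card, Fintype.card_fin]; omega
    obtain ⟨e, -, he⟩ := Set.exists_mem_notMem_of_ncard_lt_ncard hlt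
    have hi : (uniform k n).Indep (insert e B) := by
      rw [uniform_indep_iff, Set.ncard_insert_of_notMem he]; omega
    exact he (h.le_of_ge hi (Set.subset_insert e B) (Set.mem_insert e B))
  · intro h
    refine ⟨h.le, fun J hJ hBJ => ?_⟩
    have hJ' : J.ncard ≤ k := hJ
    exact (Set.eq_of_subset_of_ncard_le hBJ (by omega) (Set.toFinite J)).ge

end InverseZ

namespace InverseZ

/-! The proper flats of a uniform matroid of rank `k` on `k + m` elements are the subsets of size
less than `k`. Restricting to one gives a Boolean matroid (`m = 0`), for which `P = Q = 1`, `χ = (t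
- 1) ^ k` and `μ = (-1) ^ k`; contracting one keeps `m`. So each defining sum over flats is a
binomial convolution `T_a v = flatConv m a v` plus a separate term for the ground set, whose
contraction does not keep `m`.

The engine is the semigroup law `T_a T_b = T_(a+b)` with `T_0 = id` (`flatConv_flatConv`,
`flatConv_zero_left`). A closed form for `Q` is guessed in `uniformInvKL`, and `uniformKL` is `P =
-T_1((-1)^j Q_j)`, which is the recursion for `Q` solved for `P`. Reversing `P` turns `T_1` into
`T_X`, so the Kazhdan–Lusztig recursion becomes `χ = T_X((-1)^j (Q_j - rev Q_j))`. This follows from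
`neg_one_pow_mul_uniformInvKL_sub_reflect`; together with the degree bound it identifies `P`, then
`Q`, and `Y` is `Q` plus an explicit Möbius sum. -/

/-- A loopless uniform matroid of rank `k` on a ground set with `k + m` elements. -/
structure IsUniform {α : Type*} (M : Matroid α) (k m : ℕ) : Prop where
  indep_iff : ∀ I, M.Indep I ↔ I ⊆ M.E ∧ I.ncard ≤ k
  ncard_ground : M.E.ncard = k + m
  loopless : k = 0 → m = 0

theorem isUniform_uniform {k n : ℕ} (hk : 1 ≤ k) (hkn : k ≤ n) :
    IsUniform (uniform k n) k (n - k) where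
  indep_iff I := by simp [uniform_indep_iff, uniform_ground]
  ncard_ground := by
    rw [uniform_ground, Set.ncard_univ, Nat.card_eq_fintype_card, Fintype.card_fin]; omega
  loopless h := by omega

/-! ### Flats, minors and flat sums of uniform matroids. -/

namespace IsUniform

theorem restrict_ground {α : Type*} {M : Matroid α} {k m : ℕ}
    (h : IsUniform M k m) : IsUniform (M ↾ M.E) k m := by
  rwa [Matroid.restrict_ground_eq_self]

theorem contract_ground {α : Type*} (M : Matroid α) : IsUniform (M ／ M.E) 0 0 where
  indep_iff I := by
    constructor
    · intro hI
      have := hI.subset_ground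
      simp_all
    · rintro ⟨hI, -⟩
      simp_all
  ncard_ground := by simp
  loopless _ := rfl

variable {α : Type*} [Finite α] {M : Matroid α} {k m : ℕ} {F : Set α}

theorem rk_eq (h : IsUniform M k m) : rk M = k := by
  obtain ⟨B, hB⟩ := M.exists_isBase
  have hBk := ((h.indep_iff B).1 hB.indep).2
  have : B.ncard = k := by
    by_contra hne
    obtain ⟨e, heE, heB⟩ := Set.exists_mem_notMem_of_ncard_lt_ncard
      (show B.ncard < M.E.ncard by have := h.ncard_ground; omega)
    have hi : M.Indep (insert e B) := by
      rw [h.indep_iff, Set.ncard_insert_of_notMem heB]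
      exact ⟨Set.insert_subset heE hB.subset_ground, by omega⟩
    have heq := hB.eq_of_subset_indep hi (Set.subset_insert e B)
    exact heB (heq ▸ Set.mem_insert e B)
  rw [rk, ← hB.encard_eq_eRank]
  exact this

theorem isFlat_iff (h : IsUniform M k m) :
    M.IsFlat F ↔ F ⊆ M.E ∧ F.ncard < k ∨ F = M.E := by
  constructor
  · intro hF
    by_cases hk : F.ncard < k
    · exact Or.inl ⟨hF.subset_ground, hk⟩
    · right
      -- A flat with at least `k` elements contains a `k`-set, which already spans.
      obtain ⟨I, hIF, hI⟩ := Set.exists_subset_card_eq (not_lt.1 hk)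
      have hIi : M.Indep I := (h.indep_iff I).2 ⟨hIF.trans hF.subset_ground, hI.le⟩
      refine hF.subset_ground.antisymm fun e he => ?_
      rw [← hF.closure]
      refine M.closure_subset_closure hIF (hIi.mem_closure_iff'.2 ⟨he, fun hi => ?_⟩)
      by_contra hne
      have := ((h.indep_iff _).1 hi).2
      rw [Set.ncard_insert_of_notMem hne] at this
      omega
  · rintro (⟨hFE, hk⟩ | rfl)
    · have hFi : M.Indep F := (h.indep_iff F).2 ⟨hFE, hk.le⟩
      rw [Matroid.isFlat_iff_closure_eq]
      refine Set.Subset.antisymm (fun e he => ?_) (M.subset_closure F hFE)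
      rw [hFi.mem_closure_iff'] at he
      refine he.2 ((h.indep_iff _).2 ⟨Set.insert_subset he.1 hFE, ?_⟩)
      exact (Set.ncard_insert_le e F).trans hk
    · exact M.ground_isFlat

/-- Rank `0` needs the field `loopless`: with `k = 0 < m` every element would be a loop. -/
theorem closure_empty (h : IsUniform M k m) : M.closure ∅ = ∅ := by
  have : M.IsFlat ∅ := by
    rw [h.isFlat_iff]
    rcases Nat.eq_zero_or_pos k with hk | hk
    · right
      have := h.ncard_ground
      rw [h.loopless hk, hk, zero_add, Set.ncard_eq_zero] at this
      exact this.symm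
    · simp [hk]
  exact this.closure

theorem restrict (h : IsUniform M k m) (hF : F ⊆ M.E) (hk : F.ncard < k) :
    IsUniform (M ↾ F) F.ncard 0 where
  indep_iff I := by
    rw [Matroid.restrict_indep_iff, h.indep_iff, Matroid.restrict_ground_eq]
    exact ⟨fun hI => ⟨hI.2, Set.ncard_le_ncard hI.2⟩,
      fun hI => ⟨⟨hI.1.trans hF, hI.2.trans hk.le⟩, hI.1⟩⟩
  ncard_ground := rfl
  loopless _ := rfl

theorem contract (h : IsUniform M k m) (hF : F ⊆ M.E) (hk : F.ncard < k) :
    IsUniform (M ／ F) (k - F.ncard) m where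
  indep_iff I := by
    have hFi : M.Indep F := (h.indep_iff F).2 ⟨hF, hk.le⟩
    rw [hFi.contract_indep_iff, h.indep_iff, Matroid.contract_ground, Set.subset_sdiff]
    constructor
    · rintro ⟨hd, hs, hc⟩
      rw [Set.ncard_union_eq hd] at hc
      exact ⟨⟨Set.subset_union_left.trans hs, hd⟩, by omega⟩
    · rintro ⟨⟨hs, hd⟩, hc⟩
      rw [Set.ncard_union_eq hd]
      exact ⟨hd, Set.union_subset hs hF, by omega⟩
  ncard_ground := by
    rw [Matroid.contract_ground, Set.ncard_sdiff hF, h.ncard_ground]; omega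
  loopless h0 := by omega

open Finset in
theorem sum_flats {A : Type*} [AddCommMonoid A] (h : IsUniform M k m) (f : Set α → A) (g : ℕ → A)
    (hfg : ∀ F ⊆ M.E, F.ncard < k → f F = g F.ncard) :
    ∑ F : Flats M, f F.1 = ∑ i ∈ range k, (k + m).choose i • g i + f M.E := by
  classical
  obtain ⟨E, hE⟩ := (Set.toFinite M.E).exists_finset_coe
  have hcard : #E = k + m := by rw [← Set.ncard_coe_finset, hE, h.ncard_ground]
  have hne : E ∉ E.powerset.filter (fun s => #s < k) := by simp [hcard]
  have key : ∑ F : Flats M, f F.1 =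
      ∑ s ∈ insert E (E.powerset.filter fun s => #s < k), f (s : Set α) := by
    symm
    refine Finset.sum_bij (fun s hs => ⟨(s : Set α), ?_⟩) (by simp) ?_ ?_ (fun _ _ => rfl)
    · rw [h.isFlat_iff, ← hE, Set.ncard_coe_finset]
      rw [mem_insert, mem_filter, mem_powerset] at hs
      rcases hs with rfl | hs
      · exact Or.inr rfl
      · exact Or.inl ⟨by exact_mod_cast hs.1, hs.2⟩
    · intro s _ t _ hst
      exact Finset.coe_injective (congrArg Subtype.val hst)
    · rintro ⟨F, hF⟩ -
      obtain ⟨s, rfl⟩ := (Set.toFinite F).exists_finset_coe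
      refine ⟨s, ?_, rfl⟩
      rw [h.isFlat_iff, ← hE, Set.ncard_coe_finset] at hF
      rw [mem_insert, mem_filter, mem_powerset]
      exact_mod_cast hF.symm
  rw [key, sum_insert hne, hE, add_comm]
  congr 1
  have : ∑ s ∈ E.powerset.filter (fun s => #s < k), f (s : Set α) =
      ∑ s ∈ E.powerset, if #s < k then g #s else 0 := by
    rw [sum_filter]
    refine sum_congr rfl fun s hs => ?_
    split_ifs with hk
    · rw [hfg s (by rw [← hE]; exact_mod_cast mem_powerset.1 hs) (by rwa [Set.ncard_coe_finset]),
        Set.ncard_coe_finset]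
    · rfl
  rw [this, sum_powerset_apply_card (fun i => if i < k then g i else 0), hcard]
  simp only [smul_ite, smul_zero]
  rw [← sum_filter]
  refine sum_congr ?_ fun _ _ => rfl
  ext i
  simp only [mem_filter, mem_range]
  omega

end IsUniform

/-! ### Splitting off the least flat; recognising Möbius values. -/

theorem sum_flats_eq_add_sum_posFlats {α A : Type*} [Finite α] [AddCommMonoid A] (M : Matroid α)
    (f : Set α → A) :
    ∑ F : Flats M, f F.1 = f (M.closure ∅) + ∑ F : PosFlats M, f F.1 := by
  classical
  rw [← Finset.add_sum_erase Finset.univ _ (Finset.mem_univ (botFlat M))]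
  congr 1
  refine Finset.sum_bij (fun F hF => ⟨F.1, F.2, fun h => (Finset.ne_of_mem_erase hF)
    (Subtype.ext h)⟩) (by simp) ?_ ?_ (fun _ _ => rfl)
  · intro F _ G _ hFG
    exact Subtype.ext (congrArg (fun F : PosFlats M => F.1) hFG)
  · intro F _
    exact ⟨⟨F.1, F.2.1⟩, Finset.mem_erase.2 ⟨fun h => F.2.2 (congrArg Subtype.val h),
      Finset.mem_univ _⟩, rfl⟩

open Classical in
theorem mu_botFlat_eq {α : Type*} [Finite α] (M : Matroid α) (g : Flats M → ℤ)
    (hbot : g (botFlat M) = 1)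
    (hsum : ∀ F, F ≠ botFlat M → ∑ G ∈ Finset.univ.filter (· ≤ F), g G = 0) (F : Flats M) :
    IncidenceAlgebra.mu ℤ (botFlat M) F = g F := by
  induction F using WellFoundedLT.induction with
  | ind F ih =>
    rw [IncidenceAlgebra.mu_apply]
    split_ifs with hF
    · rw [← hF, hbot]
    · have hico : Finset.Ico (botFlat M) F = (Finset.univ.filter (· ≤ F)).erase F := by
        ext G
        have : botFlat M ≤ G := (M.closure_subset_closure (Set.empty_subset _)).trans G.2.closure.subset
        simp [this, lt_iff_le_and_ne, and_comm]
      rw [Finset.sum_congr rfl fun G hG => ih G (Finset.mem_Ico.1 hG).2, hico]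
      have := Finset.add_sum_erase (Finset.univ.filter (· ≤ F)) g (a := F) (by simp)
      rw [hsum F (Ne.symm hF)] at this
      linarith

/-! ### Binomial convolution. -/

/-- The sum over the proper flats `F` of the uniform matroid of rank `k` on `k + m` elements of
`a ^ |F| * v (k - |F|)`. -/
def flatConv {R : Type*} [CommRing R] (m : ℕ) (a : R) (v : ℕ → R) (k : ℕ) : R :=
  ∑ i ∈ Finset.range k, (k + m).choose i * a ^ i * v (k - i)

section flatConv

variable {R : Type*} [CommRing R] (m : ℕ) (a b : R) (v w : ℕ → R) (k : ℕ)

open Finset in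
-- Group the double sum by the total size `s = i + j`; trinomial revision extracts `(k + m).choose
-- s`, and the binomial theorem sums the rest to `(a + b) ^ s`. Only `v j` with `j ≥ 1` occurs, so
-- the omitted top flat does no harm.
theorem flatConv_flatConv : flatConv m a (flatConv m b v) k = flatConv m (a + b) v k := by
  simp only [flatConv, mul_sum, add_pow, sum_mul]
  rw [← sum_range_diag_flip k fun i j => (((k + m).choose i : R) * a ^ i) *
    (((k - i + m).choose j : R) * b ^ j * v (k - i - j))]
  refine sum_congr rfl fun s hs => sum_congr rfl fun i hi => ?_
  rw [mem_range] at hs hi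
  have h := Nat.choose_mul (n := k + m) (k := s) (s := i) (by omega)
  rw [show k + m - i = k - i + m by omega] at h
  have h' : ((k + m).choose s : R) * s.choose i = (k + m).choose i * (k - i + m).choose (s - i) := by
    exact_mod_cast congrArg (Nat.cast : ℕ → R) h
  rw [show k - i - (s - i) = k - s by omega]
  linear_combination (-(a ^ i * b ^ (s - i) * v (k - s))) * h'

variable {v w k}

theorem flatConv_congr (h : ∀ j, 1 ≤ j → j ≤ k → v j = w j) :
    flatConv m a v k = flatConv m a w k :=
  Finset.sum_congr rfl fun i hi => by
    rw [Finset.mem_range] at hi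
    rw [h (k - i) (by omega) (by omega)]

theorem flatConv_zero_left (hk : 1 ≤ k) : flatConv m (0 : R) v k = v k := by
  rw [flatConv, Finset.sum_eq_single_of_mem 0 (Finset.mem_range.2 hk) fun i _ hi => by simp [hi]]
  simp

variable (v w k)

theorem flatConv_add : flatConv m a (v + w) k = flatConv m a v k + flatConv m a w k := by
  simp only [flatConv, Pi.add_apply, mul_add, Finset.sum_add_distrib]

theorem flatConv_neg : flatConv m a (-v) k = -flatConv m a v k := by
  simp only [flatConv, Pi.neg_apply, mul_neg, Finset.sum_neg_distrib]

theorem flatConv_sub : flatConv m a (v - w) k = flatConv m a v k - flatConv m a w k := by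
  rw [sub_eq_add_neg, flatConv_add, flatConv_neg, sub_eq_add_neg]

theorem flatConv_mul_pow (c : R) :
    flatConv m (c * a) (fun j => c ^ j * v j) k = c ^ k * flatConv m a v k := by
  simp only [flatConv, Finset.mul_sum]
  refine Finset.sum_congr rfl fun i hi => ?_
  rw [Finset.mem_range] at hi
  rw [mul_pow, show c ^ k = c ^ i * c ^ (k - i) by rw [← pow_add]; congr 1; omega]
  ring

end flatConv

/-! ### Closed forms and the identities between them. -/

/-- The Möbius invariant of a loopless uniform matroid. -/
def uniformMobius (k m : ℕ) : ℤ := (-1) ^ k * (k + m - 1).choose m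

theorem flatConv_neg_one_one {R : Type*} [CommRing R] {k : ℕ} (m : ℕ) (hk : 1 ≤ k) :
    flatConv m (-1 : R) 1 k = -(uniformMobius k m : R) := by
  obtain ⟨k, rfl⟩ := Nat.exists_eq_add_of_le' hk
  have h := @Int.alternating_sum_range_choose_eq_choose (k + m) k
  rw [Nat.choose_symm_add] at h
  have h' := congrArg (Int.cast : ℤ → R) h
  rw [uniformMobius, show k + 1 + m - 1 = k + m by omega, pow_succ]
  push_cast at h' ⊢
  rw [flatConv, mul_neg_one, neg_mul, neg_neg, ← h']
  refine Finset.sum_congr rfl fun i _ => ?_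
  rw [Pi.one_apply, mul_one, mul_comm, show k + 1 + m = k + m + 1 by omega]

/-- The characteristic polynomial of a loopless uniform matroid of positive rank. -/
noncomputable def uniformCharPoly (k m : ℕ) : ℤ[X] :=
  flatConv m (-1) (X ^ ·) k + C (uniformMobius k m)

/-- The coefficients of the inverse `Z`-polynomial of a uniform matroid. -/
def uniformCoeff (k m i : ℕ) : ℕ := (k + m).choose i * (k + m - i - 1).choose m

/-- The inverse Kazhdan–Lusztig polynomial of a uniform matroid of positive rank. -/
noncomputable def uniformInvKL (k m : ℕ) : ℤ[X] :=
  ∑ i ∈ (Finset.range k).filter (2 * · < k), C (uniformCoeff k m i : ℤ) * X ^ i -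
    ∑ i ∈ (Finset.range k).filter (k < 2 * ·), C (uniformCoeff k m i : ℤ) * X ^ (k - i)

/-- The Kazhdan–Lusztig polynomial of a uniform matroid of positive rank. -/
noncomputable def uniformKL (k m : ℕ) : ℤ[X] :=
  -flatConv m 1 (fun j => (-1) ^ j * uniformInvKL j m) k

theorem natDegree_uniformInvKL_le (k m : ℕ) : (uniformInvKL k m).natDegree ≤ (k - 1) / 2 := by
  refine (natDegree_sub_le _ _).trans (max_le ?_ ?_) <;>
  · refine natDegree_sum_le_of_forall_le _ _ fun i hi => (natDegree_C_mul_X_pow_le _ _).trans ?_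
    rw [Finset.mem_filter, Finset.mem_range] at hi
    omega

theorem natDegree_uniformKL_le (k m : ℕ) : (uniformKL k m).natDegree ≤ (k - 1) / 2 := by
  rw [uniformKL, natDegree_neg]
  refine natDegree_sum_le_of_forall_le _ _ fun i _ => ?_
  rw [one_pow, mul_one, ← mul_assoc, ← C_eq_natCast, ← C_1, ← C_neg, ← C_pow, ← C_mul]
  refine (natDegree_C_mul_le _ _).trans ((natDegree_uniformInvKL_le _ _).trans ?_)
  omega

theorem reflect_sum {ι R : Type*} [Semiring R] (N : ℕ) (s : Finset ι) (f : ι → R[X]) :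
    reflect N (∑ i ∈ s, f i) = ∑ i ∈ s, reflect N (f i) :=
  map_sum ({ toFun := reflect N, map_zero' := reflect_zero, map_add' := fun f g => reflect_add f g N } :
    R[X] →+ R[X]) f s

theorem uniformInvKL_sub_reflect (k m : ℕ) :
    uniformInvKL k m - (uniformInvKL k m).reflect k =
      ∑ i ∈ Finset.range k, C (uniformCoeff k m i : ℤ) * (X ^ i - X ^ (k - i)) := by
  simp only [uniformInvKL, reflect_sub, reflect_sum, Finset.sum_filter,
    ← Finset.sum_sub_distrib]
  refine Finset.sum_congr rfl fun i hi => ?_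
  rw [Finset.mem_range] at hi
  simp only [apply_ite (reflect k), reflect_C_mul_X_pow, reflect_zero]
  rw [revAt_le hi.le, revAt_le (Nat.sub_le k i), Nat.sub_sub_self hi.le]
  rcases lt_trichotomy (2 * i) k with h | h | h
  · rw [if_pos h, if_neg h.not_gt, if_pos h, if_neg h.not_gt]
    ring
  -- The middle index is absent from `uniformInvKL`, and here `X ^ i - X ^ (k - i)` vanishes.
  · rw [show k - i = i by omega]
    simp [h]
  · rw [if_neg h.not_gt, if_pos h, if_neg h.not_gt, if_pos h]
    ring

/-- Both halves of the antisymmetric sum are convolutions with Möbius values. The `X ^ (k - i)` half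
becomes `T_(-1-X)(X ^ j)`, since `T_(-X)(X ^ j) = X ^ j * T_(-1)(1) = -X ^ j * μ_j`. -/
theorem neg_one_pow_mul_uniformInvKL_sub_reflect (k m : ℕ) :
    (-1) ^ k * (uniformInvKL k m - (uniformInvKL k m).reflect k) =
      flatConv m (-X) (fun j => (uniformMobius j m : ℤ[X])) k +
        flatConv m (-1 - X) (X ^ ·) k := by
  have h1 : flatConv m (-1 - X) (X ^ ·) k =
      -flatConv m (-1 : ℤ[X]) (fun j => X ^ j * (uniformMobius j m : ℤ[X])) k := by
    rw [sub_eq_add_neg, ← flatConv_flatConv, ← flatConv_neg]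
    refine flatConv_congr _ _ fun j hj _ => ?_
    have := flatConv_mul_pow m (-1 : ℤ[X]) 1 j X
    rw [flatConv_neg_one_one m hj] at this
    simpa using this
  rw [h1, uniformInvKL_sub_reflect, flatConv, flatConv, ← sub_eq_add_neg, ← Finset.sum_sub_distrib,
    Finset.mul_sum]
  refine Finset.sum_congr rfl fun i hi => ?_
  rw [Finset.mem_range] at hi
  have hsign : (-1 : ℤ[X]) ^ k = (-1) ^ i * (-1) ^ (k - i) := by
    rw [← pow_add]; congr 1; omega
  rw [uniformMobius, uniformCoeff, show k + m - i - 1 = k - i + m - 1 by omega, hsign, neg_pow (X : ℤ[X])]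
  push_cast
  simp only [map_mul, map_natCast]
  ring

/-- Applying `T_X` to the previous identity leaves `T_0 μ + T_(-1)(X ^ j)`. -/
theorem uniformCharPoly_eq_flatConv {k : ℕ} (m : ℕ) (hk : 1 ≤ k) :
    uniformCharPoly k m = flatConv m X
      (fun j => (-1) ^ j * (uniformInvKL j m - (uniformInvKL j m).reflect j)) k := by
  rw [flatConv_congr m X fun j _ _ => neg_one_pow_mul_uniformInvKL_sub_reflect j m]
  have := flatConv_add m (X : ℤ[X]) (flatConv m (-X) fun j => (uniformMobius j m : ℤ[X]))
    (flatConv m (-1 - X) (X ^ ·)) k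
  refine Eq.trans ?_ this.symm
  rw [flatConv_flatConv, flatConv_flatConv, add_neg_cancel, flatConv_zero_left m hk,
    show (X : ℤ[X]) + (-1 - X) = -1 by ring, uniformCharPoly, add_comm]
  simp

theorem reflect_uniformKL {k : ℕ} (m : ℕ) (hk : 1 ≤ k) :
    (uniformKL k m).reflect k =
      flatConv m (X - 1) (fun j => uniformKL j m) k + uniformCharPoly k m := by
  have h1 : (uniformKL k m).reflect k =
      -flatConv m X (fun j => (-1) ^ j * (uniformInvKL j m).reflect j) k := by
    rw [uniformKL, reflect_neg, flatConv, flatConv, reflect_sum]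
    congr 1
    refine Finset.sum_congr rfl fun i hi => ?_
    rw [Finset.mem_range] at hi
    -- Reversal in degree `k = i + (k - i)` sends the factor `1` to `X ^ i`, which turns `T_1` into
    -- `T_X`.
    have h := reflect_mul (1 : ℤ[X]) (uniformInvKL (k - i) m) (F := i) (G := k - i) (by simp)
      ((natDegree_uniformInvKL_le _ _).trans (by omega))
    rw [one_mul, reflect_one, show i + (k - i) = k by omega] at h
    have hC : ((k + m).choose i : ℤ[X]) * (-1) ^ (k - i) =
        C (((k + m).choose i : ℤ) * (-1) ^ (k - i)) := by simp
    calc _ = reflect k (C (((k + m).choose i : ℤ) * (-1) ^ (k - i)) * uniformInvKL (k - i) m) := by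
          rw [← hC, one_pow, mul_one, mul_assoc]
      _ = _ := by
          rw [reflect_C_mul, h, ← hC]; ring
  have h2 : flatConv m (X - 1) (fun j => uniformKL j m) k =
      -flatConv m X (fun j => (-1) ^ j * uniformInvKL j m) k := by
    have := flatConv_neg m (X - 1 : ℤ[X]) (flatConv m 1 fun j => (-1) ^ j * uniformInvKL j m) k
    refine Eq.trans this ?_
    rw [flatConv_flatConv, sub_add_cancel]
  have h3 := flatConv_sub m (X : ℤ[X]) (fun j => (-1) ^ j * uniformInvKL j m)
    (fun j => (-1) ^ j * (uniformInvKL j m).reflect j) k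
  rw [h1, h2, uniformCharPoly_eq_flatConv m hk]
  simp only [mul_sub]
  refine Eq.trans ?_ (congrArg _ h3.symm)
  ring

theorem uniformMobius_zero_right (k : ℕ) : uniformMobius k 0 = (-1) ^ k := by
  simp [uniformMobius]

theorem uniformCharPoly_zero_right (k : ℕ) : uniformCharPoly k 0 = (X - 1) ^ k := by
  rw [sub_eq_neg_add, add_pow, Finset.sum_range_succ, uniformCharPoly, uniformMobius_zero_right,
    flatConv]
  refine congrArg₂ (· + ·) (Finset.sum_congr rfl fun i _ => ?_) (by simp)
  rw [add_zero, mul_comm ((k.choose i : ℕ) : ℤ[X]), mul_right_comm]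

theorem klPoly_eq_of_reflect {α : Type*} [Finite α] {M : Matroid α} {p : ℤ[X]}
    (hdeg : 2 * p.natDegree < rk M) (hp : p.reflect (rk M) =
      p + ∑ F : PosFlats M, charPoly (M ↾ F.1) * klPoly (M ／ F.1)) : klPoly M = p := by
  have h : ∃ p : ℤ[X], 2 * p.natDegree < rk M ∧ p.reflect (rk M) =
      p + ∑ F : PosFlats M, charPoly (M ↾ F.1) * klPoly (M ／ F.1) := ⟨p, hdeg, hp⟩
  rw [klPoly, if_neg (by omega), klSolve, dif_pos h]
  exact klSolve_unique h.choose_spec ⟨hdeg, hp⟩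

/-! ### Evaluating the matroid invariants. -/

namespace IsUniform

variable {α : Type*} [Finite α] {M : Matroid α} {k m : ℕ}

open Finset in
theorem sum_posFlats {A : Type*} [AddCommMonoid A] (h : IsUniform M k m) (hk : 1 ≤ k)
    (f : Set α → A) (g : ℕ → A)
    (hfg : ∀ F ⊆ M.E, 1 ≤ F.ncard → F.ncard < k → f F = g F.ncard) :
    ∑ F : PosFlats M, f F.1 = ∑ i ∈ Ico 1 k, (k + m).choose i • g i + f M.E := by
  classical
  have hE : M.E ≠ ∅ := fun hE => by
    have := h.ncard_ground
    rw [hE, Set.ncard_empty] at this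
    omega
  -- Setting the summand to `0` at `∅` lets `sum_flats` count only the nonempty flats.
  have h1 := sum_flats_eq_add_sum_posFlats M fun F => if F = ∅ then 0 else f F
  rw [h.sum_flats (fun F => if F = ∅ then 0 else f F) (fun i => if i = 0 then 0 else g i), if_pos h.closure_empty, if_neg hE,
    zero_add, range_eq_Ico, sum_eq_sum_Ico_succ_bot hk, if_pos rfl, smul_zero, zero_add] at h1
  · refine Eq.trans (Eq.trans ?_ h1.symm) ?_
    · refine sum_congr rfl fun F _ => (if_neg fun h0 => ?_).symm
      exact F.2.2 (h0.trans h.closure_empty.symm)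
    · congr 1
      refine sum_congr rfl fun i hi => ?_
      rw [mem_Ico] at hi
      rw [if_neg (by omega)]
  · intro F hF hFk
    have := Set.ncard_eq_zero (s := F)
    by_cases hF0 : F = ∅
    · simp [hF0]
    · have h0 : F.ncard ≠ 0 := fun h0 => hF0 (this.1 h0)
      rw [if_neg hF0, if_neg h0]
      exact hfg F hF (by omega) hFk

open Classical Finset in
theorem mobius_eq (h : IsUniform M k m) : mobius M = uniformMobius k m := by
  let f : Set α → ℤ := fun F => if F.ncard < k then (-1) ^ F.ncard else uniformMobius k m
  have hE : f M.E = uniformMobius k m := if_neg (by rw [h.ncard_ground]; omega)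
  rw [mobius, mu_botFlat_eq M (fun F => f F.1), topFlat, hE]
  · change f (M.closure ∅) = 1
    rw [h.closure_empty]
    simp only [f, Set.ncard_empty, pow_zero]
    split_ifs with hk
    · rfl
    -- Here `∅` is also the top flat; truncated subtraction makes `uniformMobius 0 0 = 1`.
    · have hk0 : k = 0 := by omega
      rw [hk0, h.loopless hk0]
      rfl
  · rintro ⟨F, hF⟩ hne
    have hne' : F ≠ ∅ := fun h0 => hne (Subtype.ext (h0.trans h.closure_empty.symm))
    -- Below a proper flat the interval is Boolean, so the alternating sum vanishes; at the top,
    -- `T_(-1)(1) = -μ`.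
    rcases h.isFlat_iff.1 hF with ⟨hFE, hFk⟩ | rfl
    · obtain ⟨S, rfl⟩ := (Set.toFinite F).exists_finset_coe
      have hS : S.Nonempty := by
        rw [nonempty_iff_ne_empty]
        exact fun h0 => hne' (by simp [h0])
      rw [← sum_powerset_neg_one_pow_card_of_nonempty hS]
      symm
      have hlt : ∀ T ⊆ S, (T : Set α).ncard < k := fun T hT =>
        (Set.ncard_le_ncard (by exact_mod_cast hT) (Set.toFinite _)).trans_lt hFk
      refine sum_bij (fun T hT => ⟨(T : Set α), h.isFlat_iff.2 (Or.inl ⟨?_, ?_⟩)⟩) ?_ ?_ ?_ ?_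
      · have hTS : (T : Set α) ⊆ S := by exact_mod_cast mem_powerset.1 hT
        exact hTS.trans hFE
      · exact hlt T (mem_powerset.1 hT)
      · intro T hT
        rw [mem_filter]
        exact ⟨mem_univ _, by exact_mod_cast mem_powerset.1 hT⟩
      · intro T _ T' _ hTT
        exact coe_injective (congrArg Subtype.val hTT)
      · rintro ⟨G, hG⟩ hGS
        obtain ⟨T, rfl⟩ := (Set.toFinite G).exists_finset_coe
        have hTS : (T : Set α) ⊆ S := (mem_filter.1 hGS).2
        exact ⟨T, mem_powerset.2 (by exact_mod_cast hTS), rfl⟩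
      · intro T hT
        have := hlt T (mem_powerset.1 hT)
        simp only [f]
        rw [if_pos this, Set.ncard_coe_finset]
    · have hk : 1 ≤ k := by
        by_contra hk
        have hk0 : k = 0 := by omega
        have := h.ncard_ground
        rw [h.loopless hk0, hk0, add_zero, Set.ncard_eq_zero] at this
        exact hne' this
      rw [filter_true_of_mem fun G _ => G.2.subset_ground,
        h.sum_flats f (fun i => (-1) ^ i) (fun F _ hF => if_pos hF), hE]
      have := flatConv_neg_one_one (R := ℤ) m hk
      simp only [flatConv, Pi.one_apply, mul_one, Int.cast_id] at this
      simp only [nsmul_eq_mul, this, neg_add_cancel]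

theorem charPoly_eq (h : IsUniform M k m) : charPoly M = uniformCharPoly k m := by
  rw [charPoly, h.sum_flats (fun F => C (mobius (M ↾ F)) * X ^ rk (M ／ F))
    (fun i => C ((-1) ^ i) * X ^ (k - i)), h.restrict_ground.mobius_eq,
    (contract_ground M).rk_eq, uniformCharPoly, flatConv]
  · congr 1
    · refine Finset.sum_congr rfl fun i _ => ?_
      simp [mul_assoc]
    · simp
  · intro F hF hFk
    rw [(h.restrict hF hFk).mobius_eq, (h.contract hF hFk).rk_eq, uniformMobius_zero_right]

theorem klPoly_eq_one (h : IsUniform M k 0) : klPoly M = 1 := by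
  induction k using Nat.strong_induction_on generalizing M with
  | _ k ih =>
    rcases Nat.eq_zero_or_pos k with hk | hk
    · rw [klPoly, if_pos (h.rk_eq.trans hk)]
    · apply klPoly_eq_of_reflect
      · rw [h.rk_eq, natDegree_one]
        omega
      · rw [h.rk_eq, reflect_one,
          h.sum_posFlats hk (fun F => charPoly (M ↾ F) * klPoly (M ／ F)) (fun i => (X - 1) ^ i),
          h.restrict_ground.charPoly_eq, ih 0 hk (contract_ground M), uniformCharPoly_zero_right]
        -- The recursion with `P = 1` is the expansion of `X ^ k = ((X - 1) + 1) ^ k`.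
        · have := add_pow (X - 1 : ℤ[X]) 1 k
          rw [sub_add_cancel, Finset.sum_range_succ, Finset.range_eq_Ico,
            Finset.sum_eq_sum_Ico_succ_bot hk] at this
          rw [this]
          simp [mul_comm, add_assoc]
        · intro F hF hF1 hFk
          rw [(h.restrict hF hFk).charPoly_eq, ih _ (by omega) (h.contract hF hFk),
            uniformCharPoly_zero_right, mul_one]

theorem invKLPoly_eq_one (h : IsUniform M k 0) : invKLPoly M = 1 := by
  induction k using Nat.strong_induction_on generalizing M with
  | _ k ih =>
    rcases Nat.eq_zero_or_pos k with hk | hk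
    · rw [invKLPoly, if_pos (h.rk_eq.trans hk)]
    · rw [invKLPoly, if_neg (by rw [h.rk_eq]; omega),
        h.sum_posFlats hk (fun F => (-1) ^ rk (M ↾ F) * klPoly (M ↾ F) * invKLPoly (M ／ F))
          (fun i => (-1) ^ i), h.restrict_ground.rk_eq, h.restrict_ground.klPoly_eq_one,
        ih 0 hk (contract_ground M)]
      · have := add_pow (-1 : ℤ[X]) 1 k
        rw [neg_add_cancel, zero_pow (by omega), Finset.sum_range_succ, Finset.range_eq_Ico,
          Finset.sum_eq_sum_Ico_succ_bot hk] at this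
        simp only [nsmul_eq_mul, add_zero, mul_one, zero_add, one_pow, pow_zero, Nat.choose_zero_right,
          Nat.choose_self, Nat.cast_one, add_assoc] at this ⊢
        simp only [mul_comm ((k.choose _ : ℕ) : ℤ[X])]
        linear_combination this
      · intro F hF hF1 hFk
        rw [(h.restrict hF hFk).rk_eq, (h.restrict hF hFk).klPoly_eq_one,
          ih _ (by omega) (h.contract hF hFk), mul_one, mul_one]

theorem klPoly_eq (h : IsUniform M k m) (hk : 1 ≤ k) : klPoly M = uniformKL k m := by
  induction k using Nat.strong_induction_on generalizing M with
  | _ k ih =>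
    have hdeg := natDegree_uniformKL_le k m
    apply klPoly_eq_of_reflect
    · rw [h.rk_eq]
      omega
    · rw [h.rk_eq, reflect_uniformKL m hk,
        h.sum_posFlats hk (fun F => charPoly (M ↾ F) * klPoly (M ／ F))
          (fun i => (X - 1) ^ i * uniformKL (k - i) m),
        h.restrict_ground.charPoly_eq, (contract_ground M).klPoly_eq_one, flatConv,
        Finset.range_eq_Ico, Finset.sum_eq_sum_Ico_succ_bot hk]
      · simp [mul_assoc, add_assoc]
      · intro F hF hF1 hFk
        rw [(h.restrict hF hFk).charPoly_eq, ih _ (by omega) (h.contract hF hFk) (by omega),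
          uniformCharPoly_zero_right]

theorem invKLPoly_eq (h : IsUniform M k m) (hk : 1 ≤ k) : invKLPoly M = uniformInvKL k m := by
  induction k using Nat.strong_induction_on generalizing M with
  | _ k ih =>
    rw [invKLPoly, if_neg (by rw [h.rk_eq]; omega),
      h.sum_posFlats hk (fun F => (-1) ^ rk (M ↾ F) * klPoly (M ↾ F) * invKLPoly (M ／ F))
        (fun i => (-1) ^ i * uniformInvKL (k - i) m), h.restrict_ground.rk_eq,
      h.restrict_ground.klPoly_eq hk, (contract_ground M).invKLPoly_eq_one, uniformKL]
    -- The recursion reads `T_(-1) Q + (-1)^k P = 0`; pulling signs through the convolution matches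
    -- it with the definition of `uniformKL`.
    · have h1 : flatConv m (1 : ℤ[X]) (fun j => (-1) ^ j * uniformInvKL j m) k =
          (-1) ^ k * flatConv m (-1 : ℤ[X]) (fun j => uniformInvKL j m) k := by
        rw [← flatConv_mul_pow, neg_one_mul, neg_neg]
      have hsq : (-1 : ℤ[X]) ^ k * (-1) ^ k = 1 := by rw [← mul_pow]; simp
      have h2 : flatConv m (-1 : ℤ[X]) (fun j => uniformInvKL j m) k = uniformInvKL k m +
          ∑ i ∈ Finset.Ico 1 k, (k + m).choose i • ((-1) ^ i * uniformInvKL (k - i) m) := by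
        rw [flatConv, Finset.range_eq_Ico, Finset.sum_eq_sum_Ico_succ_bot hk]
        simp [mul_assoc]
      rw [h1]
      linear_combination
        flatConv m (-1 : ℤ[X]) (fun j => uniformInvKL j m) k * hsq + h2
    · intro F hF hF1 hFk
      rw [(h.restrict hF hFk).rk_eq, (h.restrict hF hFk).klPoly_eq_one,
        ih _ (by omega) (h.contract hF hFk) (by omega), mul_one]

theorem inverseZPoly_eq (h : IsUniform M k m) (hk : 1 ≤ k) :
    inverseZPoly M = uniformInvKL k m +
      ∑ i ∈ Finset.range k, C (uniformCoeff k m i : ℤ) * X ^ (k - i) := by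
  have hsq : (-1 : ℤ[X]) ^ k * (-1) ^ k = 1 := by rw [← mul_pow]; simp
  rw [inverseZPoly, Matroid.loops, h.closure_empty, Matroid.delete_empty, h.rk_eq, hatY,
    h.sum_flats (fun F => (-1) ^ rk (M ↾ F) * invKLPoly (M ↾ F) * X ^ rk (M ／ F) *
      C (mobius (M ／ F))) (fun i => (-1) ^ i * X ^ (k - i) * C (uniformMobius (k - i) m)),
    h.restrict_ground.rk_eq, h.restrict_ground.invKLPoly_eq hk, (contract_ground M).rk_eq,
    (contract_ground M).mobius_eq, uniformMobius_zero_right, mul_add, add_comm, Finset.mul_sum]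
  · congr 1
    · rw [pow_zero, pow_zero, C_1]
      linear_combination uniformInvKL k m * hsq
    · refine Finset.sum_congr rfl fun i hi => ?_
      rw [Finset.mem_range] at hi
      have hsign : (-1 : ℤ[X]) ^ k = (-1) ^ i * (-1) ^ (k - i) := by
        rw [← pow_add]; congr 1; omega
      rw [uniformMobius, uniformCoeff, show k + m - i - 1 = k - i + m - 1 by omega]
      simp only [nsmul_eq_mul, Nat.cast_mul, map_mul, map_natCast, map_pow, map_neg, map_one]
      have hs : (-1 : ℤ[X]) ^ k * ((-1) ^ i * (-1) ^ (k - i)) = 1 := by rw [← hsign, hsq]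
      linear_combination
        (((k + m).choose i : ℤ[X]) * ((k - i + m - 1).choose m : ℤ[X]) * X ^ (k - i)) * hs
  · intro F hF hFk
    rw [(h.restrict hF hFk).rk_eq, (h.restrict hF hFk).invKLPoly_eq_one, (h.contract hF hFk).rk_eq,
      (h.contract hF hFk).mobius_eq, mul_one]

end IsUniform

/-! ### Assembling the final formula. -/

/-- The negative terms of `uniformInvKL` cancel the summands with `2 * i > k`; the middle one, if
any, supplies the last term `i = k / 2` of the first sum. -/
theorem uniformInvKL_add_sum {k : ℕ} (m : ℕ) (hk : 1 ≤ k) :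
    uniformInvKL k m + ∑ i ∈ Finset.range k, C (uniformCoeff k m i : ℤ) * X ^ (k - i) =
      ∑ i ∈ Finset.range (k / 2 + 1), C (uniformCoeff k m i : ℤ) * X ^ i +
        ∑ i ∈ Finset.range ((k - 1) / 2 + 1), C (uniformCoeff k m i : ℤ) * X ^ (k - i) := by
  have h1 : Finset.range (k / 2 + 1) = (Finset.range k).filter (2 * · ≤ k) := by
    ext i
    simp only [Finset.mem_filter, Finset.mem_range]
    omega
  have h2 : Finset.range ((k - 1) / 2 + 1) = (Finset.range k).filter (2 * · < k) := by
    ext i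
    simp only [Finset.mem_filter, Finset.mem_range]
    omega
  rw [h1, h2, uniformInvKL]
  simp only [Finset.sum_filter, ← Finset.sum_sub_distrib, ← Finset.sum_add_distrib]
  refine Finset.sum_congr rfl fun i hi => ?_
  rcases lt_trichotomy (2 * i) k with h | h | h
  · simp [h, h.le, h.not_gt]
  · simp [h, show k - i = i by omega]
  · simp [h, h.not_ge, h.not_gt]

end InverseZ

theorem theorem1p1 (k n : ℕ) (hk : 1 ≤ k) (hkn : k ≤ n) :
    InverseZ.inverseZPoly (InverseZ.uniform k n) =
      ∑ i ∈ Finset.range (k / 2 + 1),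
          C (((n.choose i * (n - i - 1).choose (n - k) : ℕ) : ℤ)) * X ^ i +
        ∑ i ∈ Finset.range ((k - 1) / 2 + 1),
          C (((n.choose i * (n - i - 1).choose (n - k) : ℕ) : ℤ)) * X ^ (k - i) := by
  rw [(InverseZ.isUniform_uniform hk hkn).inverseZPoly_eq hk, InverseZ.uniformInvKL_add_sum _ hk]
  simp only [InverseZ.uniformCoeff, Nat.add_sub_cancel' hkn]
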